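/- Let $\Lambda=\mathbb C[p_1,p_2,p_3,\dots]$ be the ring of symmetric functions ($p_k$ the power sums), and define operators $B_n$ ($n\in\mathbb Z$) on $\Lambda$ by $$\sum_{n\in\mathbb Z}B_nt^n=\exp\Big(\sum_{k\ge1}\frac{t^k}{k}p_k\Big)\exp\Big(-\sum_{k\ge1}t^{-k}\frac{\partial}{\partial p_k}\Big).$$ A composition is a finite sequence $\mu=(\mu_1,\dots,\mu_l)$ of nonnegative integers, and a partition is a weakly decreasing one; put $B_\mu=B_{\mu_1}B_{\mu_2}\cdots B_{\mu_l}$ (the identity if $l=0$). Draw the Young diagram of $\mu$ in the fourth quadrant, with $\mu_i$ left-aligned boxes in the $i$-th row from the top. The code of $\mu$ is the doubly infinite word in the letters $R,L,U$ (unit right, left and up steps) obtained by going up the negative $y$-axis to $(0,-l)$, then tracing the right edge of the diagram up to the $x$-axis, then going right along the positive $x$-axis; the place of $(0,-l)$ in the word is remembered, so that $\mu$ is determined by its code. The code need not be reduced: the finite path that starts at $(0,-l)$ may contain cancelling pairs $LR$ or $RL$, as long as its up steps, from bottom to top, are the right ends of the rows $\mu_l,\dots,\mu_1$. Let $\mu$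 be a composition with code $\alpha$, reduced or not. Apply the following algorithm to $\alpha$, starting with $j=0$. As long as the word contains a letter $L$, make a pass: read letters from left to right, beginning with the leftmost $L$, deleting each letter once it has been read (the word closes up), and keep track of a current position in the word, which at first is that of the same $L$. - When an $L$ or an $R$ is read, the current position moves one place to the left or to the right, respectively. - When a $U$ is read and the letter in the current position is a $U$, the algorithm ends with outcome $0$. - When a $U$ is read and the letter in the current position is an $R$, the number of $U$'s strictly between the two positions is added to $j$, this $R$ is replaced by a $U$, and the current position moves one place to the right. The pass stops when, after a letter has been read, the current position is that of the next letter to be read. Then the algorithm terminates, with a uniquely determined outcome, which is either $0$ or a word $w$ without the letter $L$ together with a number $j$. If the outcome is $0$, then $B_\mu=0$. If the outcome is $(w,j)$, then $w$ is the reduced code of a unique partition $\lambda$; it has the same length $l$ as $\mu$ (parts equal to $0$ are allowed), and $$B_\mu=(-1)^jB_\lambda .$$ -/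

import Mathlib

namespace BernsteinCode

/-! ### Bernstein operators -/

/-- The ring `Λ = ℂ[p₁, p₂, p₃, …]` of symmetric functions over `ℂ`, presented as the polynomial
ring in the power sums; `MvPolynomial.X k` is the power sum `p_k`. -/
abbrev SymFun : Type := MvPolynomial ℕ+ ℂ

/-- The formal exponential `exp f = ∑_{r ≥ 0} f ^ r / r!` of a power series `f` without constant
term over a (possibly noncommutative) `ℂ`-algebra. As `f ^ r` has no terms of degree below `r`, only
the exponents `r ≤ n` contribute to the coefficient of degree `n`. -/
noncomputable def expSeries {A : Type*} [Ring A] [Algebra ℂ A] (f : PowerSeries A) :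
    PowerSeries A :=
  PowerSeries.mk fun n =>
    ∑ r ∈ Finset.range (n + 1), ((r.factorial : ℂ)⁻¹) • PowerSeries.coeff n (f ^ r)

/-- `∑_{k ≥ 1} (t ^ k / k) p_k`, a power series in `t` over `Λ`. -/
noncomputable def powerSumSeries : PowerSeries SymFun :=
  PowerSeries.mk fun k =>
    if h : 0 < k then ((k : ℂ)⁻¹) • (MvPolynomial.X (Nat.toPNat k h) : SymFun) else 0

/-- The operator `∂/∂p_k` on `Λ`. -/
noncomputable def derivOp (k : ℕ+) : Module.End ℂ SymFun :=
  (MvPolynomial.pderiv k).toLinearMap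

/-- `-∑_{k ≥ 1} u ^ k ∂/∂p_k`, a power series in `u = t⁻¹` over the linear operators on `Λ`. -/
noncomputable def derivSeries : PowerSeries (Module.End ℂ SymFun) :=
  PowerSeries.mk fun k =>
    if h : 0 < k then -derivOp (Nat.toPNat k h) else 0

/-- The coefficient of `t ^ a` in `exp (∑_{k ≥ 1} (t ^ k / k) p_k)`, for `a` an integer. -/
noncomputable def creationCoeff (a : ℤ) : SymFun :=
  if 0 ≤ a then PowerSeries.coeff a.toNat (expSeries powerSumSeries) else 0

/-- The coefficient of `t ^ (-b)` in `exp (-∑_{k ≥ 1} t ^ (-k) ∂/∂p_k)`, an operator on `Λ`. -/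
noncomputable def annihilationCoeff (b : ℕ) : Module.End ℂ SymFun :=
  PowerSeries.coeff b (expSeries derivSeries)

/-- The weight `∑ k * e_k` of the monomial `∏ p_k ^ e_k`. -/
def monWeight (m : ℕ+ →₀ ℕ) : ℕ := m.sum fun k e => (k : ℕ) * e

lemma monWeight_add_single (m : ℕ+ →₀ ℕ) (k : ℕ+) :
    monWeight (m + Finsupp.single k 1) = monWeight m + k := by
  unfold monWeight
  rw [Finsupp.sum_add_index' (by simp) (by intros; ring)]
  simp

/-- The span of the monomials of weight at most `d - n` (zero if `n > d`). -/
noncomputable def lowWeight (d n : ℕ) : Submodule ℂ SymFun :=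
  MvPolynomial.restrictSupport ℂ {m | monWeight m + n ≤ d}

lemma derivOp_mem_lowWeight {d n : ℕ} {f : SymFun} (hf : f ∈ lowWeight d n) (k : ℕ+) :
    derivOp k f ∈ lowWeight d (n + k) := by
  change MvPolynomial.pderiv k f ∈ lowWeight d (n + k)
  unfold lowWeight at *
  rw [MvPolynomial.mem_restrictSupport_iff] at *
  intro m hm
  have hm' : MvPolynomial.coeff m (MvPolynomial.pderiv k f) ≠ 0 := by simpa using hm
  rw [MvPolynomial.coeff_pderiv] at hm'
  have h1 : MvPolynomial.coeff (m + Finsupp.single k 1) f ≠ 0 := by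
    intro h; apply hm'; simp [h]
  have h2 := hf (by simpa using h1 : m + Finsupp.single k 1 ∈ (f.support : Set _))
  simp only [Set.mem_ofPred_eq, monWeight_add_single] at h2 ⊢
  omega

lemma coeff_derivSeries_mem {d n : ℕ} {f : SymFun} (hf : f ∈ lowWeight d n) (b : ℕ) :
    PowerSeries.coeff b derivSeries f ∈ lowWeight d (n + b) := by
  rw [derivSeries, PowerSeries.coeff_mk]
  by_cases hb : 0 < b
  · rw [dif_pos hb, LinearMap.neg_apply]
    exact Submodule.neg_mem _ (derivOp_mem_lowWeight hf (Nat.toPNat b hb))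
  · rw [dif_neg hb, LinearMap.zero_apply]
    exact Submodule.zero_mem _

lemma derivSeries_pow_mem (d r : ℕ) : ∀ (n b : ℕ) (f : SymFun), f ∈ lowWeight d n →
    PowerSeries.coeff b (derivSeries ^ r) f ∈ lowWeight d (n + b) := by
  induction r with
  | zero =>
    intro n b f hf
    rw [pow_zero, PowerSeries.coeff_one]
    split_ifs with h
    · subst h; simpa using hf
    · simp
  | succ r ih =>
    intro n b f hf
    rw [pow_succ, PowerSeries.coeff_mul, LinearMap.sum_apply]
    refine Submodule.sum_mem _ fun x hx => ?_
    have hx := Finset.HasAntidiagonal.mem_antidiagonal.1 hx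
    rw [Module.End.mul_apply]
    have h := coeff_derivSeries_mem hf x.2
    have := ih _ x.1 _ h
    rwa [show n + x.2 + x.1 = n + b by omega] at this

/-- Every symmetric function is killed by all but finitely many coefficients of the second
exponential, so that the sum defining a Bernstein operator is finite on each argument. -/
lemma annihilationCoeff_support_finite (f : SymFun) :
    {b : ℕ | annihilationCoeff b f ≠ 0}.Finite := by
  have hf : f ∈ lowWeight (f.support.sup monWeight) 0 := by
    unfold lowWeight
    rw [MvPolynomial.mem_restrictSupport_iff]
    intro m hm
    simpa using Finset.le_sup (f := monWeight) (Finset.mem_coe.1 hm)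
  refine (Set.finite_le_nat (f.support.sup monWeight)).subset fun b hb => ?_
  by_contra hlt
  simp only [Set.mem_ofPred_eq, not_le] at hlt
  apply hb
  rw [annihilationCoeff, expSeries, PowerSeries.coeff_mk, LinearMap.sum_apply]
  refine Finset.sum_eq_zero fun r _ => ?_
  rw [LinearMap.smul_apply]
  have h := derivSeries_pow_mem _ r 0 b f hf
  unfold lowWeight at h
  rw [MvPolynomial.mem_restrictSupport_iff] at h
  have h0 : PowerSeries.coeff b (derivSeries ^ r) f = 0 := by
    rw [← MvPolynomial.support_eq_empty, Finset.eq_empty_iff_forall_notMem]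
    intro m hm
    have := h (Finset.mem_coe.2 hm)
    simp only [Set.mem_ofPred_eq] at this
    omega
  rw [h0, smul_zero]

lemma bernstein_summand_support_finite (n : ℤ) (f : SymFun) :
    (Function.support fun b : ℕ => creationCoeff (n + b) * annihilationCoeff b f).Finite :=
  (annihilationCoeff_support_finite f).subset fun b hb h => hb (by simp [h])

/-- The Bernstein operator `B_n`: the coefficient of `t ^ n` in
`B(t) = exp (∑_{k ≥ 1} (t ^ k / k) p_k) exp (-∑_{k ≥ 1} t ^ (-k) ∂/∂p_k)`. -/
noncomputable def bernstein (n : ℤ) : Module.End ℂ SymFun where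
  toFun f := ∑ᶠ b : ℕ, creationCoeff (n + b) * annihilationCoeff b f
  map_add' f g := by
    rw [← finsum_add_distrib (bernstein_summand_support_finite n f)
      (bernstein_summand_support_finite n g)]
    simp only [map_add, mul_add]
  map_smul' c f := by
    rw [RingHom.id_apply, smul_finsum' c (bernstein_summand_support_finite n f)]
    simp only [map_smul, mul_smul_comm]

/-- `B_μ = B_{μ₁} B_{μ₂} ⋯ B_{μ_l}`, the composite of the operators; the identity if `l = 0`. -/
noncomputable def bernsteinComp (μ : List ℕ) : Module.End ℂ SymFun :=
  (μ.map fun i : ℕ => bernstein (i : ℤ)).prod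

/-! ### Codes

A composition is a list `[μ₁, …, μ_l]` of nonnegative integers, and a partition is a weakly
decreasing one; row `1` of the Young diagram is the top row. -/

/-- The letters of codes: a unit right, left or up step. -/
inductive Letter
  | R
  | L
  | U
  deriving DecidableEq

/-- Doubly infinite sequences of letters. -/
abbrev Code : Type := ℤ → Letter

/-- The sequence `… U U U v R R R …`: up the negative `y`-axis, along the finite path `v`, which
starts with letter number `0`, and then along the positive `x`-axis. -/
def Code.ofWord (v : List Letter) : Code :=
  fun i => if i < 0 then Letter.U else v.getD i.toNat Letter.R

/-- The abscissae of the up steps of the path `v` that starts at abscissa `x`, in order. -/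
def upSteps : ℤ → List Letter → List ℤ
  | _, [] => []
  | x, Letter.R :: v => upSteps (x + 1) v
  | x, Letter.L :: v => upSteps (x - 1) v
  | x, Letter.U :: v => x :: upSteps x v

/-- `α` is a code, reduced or not, of the composition `μ` of length `l`: from the point `(0, -l)` on,
which its letter number `0` leaves, it follows a finite path whose up steps, from bottom to top, are
the right ends of the rows of the Young diagram of `μ`, and then the positive `x`-axis. There may be
adjacent letters `R L` or `L R`, which cancel. -/
def IsCode (α : Code) (μ : List ℕ) : Prop :=
  ∃ v : List Letter, α = Code.ofWord v ∧ upSteps 0 v = μ.reverse.map (fun i : ℕ => (i : ℤ))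

/-- The reduced path along the right ends of rows of the given lengths (listed from bottom to top)
that starts at abscissa `x`: it moves horizontally to the end of the next row, up, and so on. -/
def edgeWord : ℕ → List ℕ → List Letter
  | _, [] => []
  | x, m :: ms =>
    List.replicate (m - x) Letter.R ++ List.replicate (x - m) Letter.L ++
      Letter.U :: edgeWord m ms

/-- The (reduced) code of the composition `μ`, which traces the right edge of its Young diagram. -/
def code (μ : List ℕ) : Code :=
  Code.ofWord (edgeWord 0 μ.reverse)

lemma upSteps_replicate_R (x : ℤ) (n : ℕ) (v : List Letter) :
    upSteps x (List.replicate n Letter.R ++ v) = upSteps (x + n) v := by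
  induction n generalizing x with
  | zero => simp
  | succ n ih =>
    rw [List.replicate_succ, List.cons_append, upSteps, ih]
    congr 1; push_cast; ring

lemma upSteps_replicate_L (x : ℤ) (n : ℕ) (v : List Letter) :
    upSteps x (List.replicate n Letter.L ++ v) = upSteps (x - n) v := by
  induction n generalizing x with
  | zero => simp
  | succ n ih =>
    rw [List.replicate_succ, List.cons_append, upSteps, ih]
    congr 1; push_cast; ring

lemma upSteps_edgeWord (x : ℕ) (ms : List ℕ) :
    upSteps x (edgeWord x ms) = ms.map (fun i : ℕ => (i : ℤ)) := by
  induction ms generalizing x with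
  | nil => rfl
  | cons m ms ih =>
    have h : (x : ℤ) + ((m - x : ℕ) : ℤ) - ((x - m : ℕ) : ℤ) = (m : ℤ) := by omega
    rw [edgeWord, List.append_assoc, upSteps_replicate_R, upSteps_replicate_L, h, upSteps, ih,
      List.map_cons]

/-- The code of `μ` is one of the codes of `μ` in the wider sense. -/
lemma isCode_code (μ : List ℕ) : IsCode (code μ) μ :=
  ⟨_, rfl, by simpa using upSteps_edgeWord 0 μ.reverse⟩

/-! ### The algorithm -/

/-- Delete the letter number `r` from `w`; the letters to its right close up the gap. -/
def Code.delete (w : Code) (r : ℤ) : Code :=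
  fun i => if i < r then w i else w (i + 1)

/-- The states of the algorithm. The counter `j` is the exponent of the sign found so far. -/
inductive State
  /-- Between two passes: the word is `w`, and its leftmost `L`, if any, is to be found. -/
  | between (w : Code) (j : ℕ)
  /-- During a pass: the letters read so far are deleted, and the remaining word is `w`; the next
  letter to be read is number `r`, and the current position is number `c`. -/
  | reading (w : Code) (r c : ℤ) (j : ℕ)
  /-- A `U` was read while the letter in the current position was a `U`. -/
  | zero

/-- The steps of the algorithm. As the letters that are read are deleted, the number `r` of the next
letter to be read stays the same during a pass. -/
inductive Step : State → State → Prop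
  /-- A pass starts with reading (and deleting) the leftmost `L`. The current position starts at
  the same `L` and moves one position left. -/
  | start (w : Code) (r : ℤ) (j : ℕ) (hr : w r = Letter.L) (hl : ∀ i < r, w i ≠ Letter.L) :
      Step (.between w j) (.reading (w.delete r) r (r - 1) j)
  /-- An `L` is read: move left. -/
  | readL (w : Code) (r c : ℤ) (j : ℕ) (hc : c ≠ r) (hr : w r = Letter.L) :
      Step (.reading w r c j) (.reading (w.delete r) r (c - 1) j)
  /-- An `R` is read: move right. -/
  | readR (w : Code) (r c : ℤ) (j : ℕ) (hc : c ≠ r) (hr : w r = Letter.R) :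
      Step (.reading w r c j) (.reading (w.delete r) r (c + 1) j)
  /-- A `U` is read against a `U`. -/
  | readUU (w : Code) (r c : ℤ) (j : ℕ) (hc : c ≠ r) (hr : w r = Letter.U)
      (hw : w c = Letter.U) : Step (.reading w r c j) .zero
  /-- A `U` is read against an `R`: this `R` becomes a `U`, the number of `U`s strictly between the
  two positions is added to `j`, and the current position moves right. -/
  | readUR (w : Code) (r c : ℤ) (j : ℕ) (hc : c ≠ r) (hr : w r = Letter.U)
      (hw : w c = Letter.R) :
      Step (.reading w r c j)
        (.reading (Code.delete (Function.update w c Letter.U) r) r (c + 1)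
          (j + ((Finset.Ioo c r).filter fun i => w i = Letter.U).card))
  /-- A pass stops when the current position is that of the next letter to be read. -/
  | finish (w : Code) (r : ℤ) (j : ℕ) : Step (.reading w r r j) (.between w j)

/-- The final states: the outcome zero, and the words without the letter `L`. -/
inductive Final : State → Prop
  | zero : Final .zero
  | word (w : Code) (j : ℕ) (h : ∀ i, w i ≠ Letter.L) : Final (.between w j)

/-- Started on the sequence `α`, the algorithm ends in the final state `s`. -/
def EndsIn (α : Code) (s : State) : Prop :=
  Relation.ReflTransGen Step (.between α 0) s ∧ Final s

end BernsteinCode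

namespace BernsteinCode

/-! ### Exponentials of power series over noncommutative algebras -/

section ExpSeries

variable {A : Type*} [Ring A]

/-! Everything follows from B_m B_n = -B_{n-1} B_{m+1} (`bernstein_mul_bernstein`). Let h_a and E_b
be the coefficients of the two exponentials. The differential equation of the exponential gives
recursions for both, and these yield E_b h_a = h_a E_b - h_{a-1} E_{b-1}. Hence B_m B_n = T(m, n) -
T(m+1, n-1), where T is normally ordered and symmetric.

List the rows from bottom to top. By exchanges of neighbours an entry moves forward past k others:
it grows by k, each of them drops by 1, and the sign is (-1)^k (`bernsteinProd_insert`). If it then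
stands just after an entry larger by 1, the product is 0 (`bernsteinProd_eq_zero`).

During a pass the word is `a ++ v`, with `a` free of `L` and `v` unread. The invariant `Reading`
says that B_μ is (-1)^j times the product over the up steps of `a` followed by those of `v`, where
`v` starts at abscissa c - #U(a). Reading `L` or `R` moves c and this abscissa alike. When a `U` is
read, write a = a₁ b a₂ with b in place c, and let y be the abscissa at the end of a₁. If b is `R`,
the entry read is y - #U(a₂); moved in front of the steps of a₂ it becomes y, and a₂ starts at y
instead of y + 1, which is the effect of replacing b by `U`. If b is `U`, the entry is y - 1 -
#U(a₂) and the product vanishes. When c reaches the end of `a`, the path `v` continues `a`, and the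
word is an honest path again. Since `v` only gets shorter, the algorithm ends. -/

lemma commute_coeff_pow {f : PowerSeries A} {x : A}
    (h : ∀ n, Commute x (PowerSeries.coeff n f)) (r n : ℕ) :
    Commute x (PowerSeries.coeff n (f ^ r)) := by
  induction r generalizing n with
  | zero =>
    rw [pow_zero, PowerSeries.coeff_one]
    split_ifs
    · exact Commute.one_right x
    · exact Commute.zero_right x
  | succ r ih =>
    rw [pow_succ, PowerSeries.coeff_mul]
    exact Commute.sum_right _ _ _ fun p _ => (ih p.1).mul_right (h p.2)

lemma coeff_pow_eq_zero_of_lt {f : PowerSeries A} (h0 : PowerSeries.coeff 0 f = 0) {r n : ℕ}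
    (h : n < r) : PowerSeries.coeff n (f ^ r) = 0 := by
  induction r generalizing n with
  | zero => omega
  | succ r ih =>
    rw [pow_succ, PowerSeries.coeff_mul]
    refine Finset.sum_eq_zero fun p hp => ?_
    have hp := Finset.HasAntidiagonal.mem_antidiagonal.1 hp
    rcases Nat.eq_zero_or_pos p.2 with h2 | h2
    · rw [h2, h0, mul_zero]
    · rw [ih (by omega), zero_mul]

/-- The Euler operator `t d/dt` on power series. -/
noncomputable def eulerDeriv (f : PowerSeries A) : PowerSeries A :=
  PowerSeries.mk fun n => n • PowerSeries.coeff n f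

lemma eulerDeriv_mul (f g : PowerSeries A) :
    eulerDeriv (f * g) = eulerDeriv f * g + f * eulerDeriv g := by
  ext n
  simp only [eulerDeriv, map_add, PowerSeries.coeff_mk, PowerSeries.coeff_mul]
  rw [Finset.smul_sum, ← Finset.sum_add_distrib]
  refine Finset.sum_congr rfl fun p hp => ?_
  rw [← Finset.HasAntidiagonal.mem_antidiagonal.1 hp, add_smul, smul_mul_assoc, mul_smul_comm]

/-- Commuting coefficients make f commute with its derivative, which the power rule needs over a
noncommutative ring. -/
lemma eulerDeriv_pow {f : PowerSeries A}
    (h : ∀ m n, Commute (PowerSeries.coeff m f) (PowerSeries.coeff n f)) (r : ℕ) :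
    eulerDeriv (f ^ (r + 1)) = (r + 1) • (f ^ r * eulerDeriv f) := by
  have hc : Commute f (eulerDeriv f) := by
    refine PowerSeries.ext fun n => ?_
    rw [PowerSeries.coeff_mul, PowerSeries.coeff_mul, ← Finset.Nat.sum_antidiagonal_swap]
    refine Finset.sum_congr rfl fun p _ => ?_
    simp only [eulerDeriv, PowerSeries.coeff_mk, Prod.fst_swap, Prod.snd_swap]
    exact (h _ _).smul_right _
  induction r with
  | zero => simp
  | succ r ih =>
    rw [pow_succ, eulerDeriv_mul, ih, smul_mul_assoc, mul_assoc, ← hc.eq, ← mul_assoc, ← pow_succ,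
      add_smul (r + 1) 1, one_smul]

variable [Algebra ℂ A]

lemma commute_coeff_expSeries {f : PowerSeries A} {x : A}
    (h : ∀ n, Commute x (PowerSeries.coeff n f)) (n : ℕ) :
    Commute x (PowerSeries.coeff n (expSeries f)) := by
  rw [expSeries, PowerSeries.coeff_mk]
  exact Commute.sum_right _ _ _ fun r _ => (commute_coeff_pow h r n).smul_right _

/-- A cutoff shared by all coefficients in a convolution allows the sums to be exchanged. -/
lemma coeff_expSeries_eq_sum_range {f : PowerSeries A} (h0 : PowerSeries.coeff 0 f = 0) {n N : ℕ}
    (h : n < N) : PowerSeries.coeff n (expSeries f) =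
      ∑ r ∈ Finset.range N, ((r.factorial : ℂ)⁻¹) • PowerSeries.coeff n (f ^ r) := by
  rw [expSeries, PowerSeries.coeff_mk]
  refine Finset.sum_subset (fun r hr => ?_) fun r _ hr => ?_
  · simp only [Finset.mem_range] at *; omega
  · rw [coeff_pow_eq_zero_of_lt h0 (by simpa using hr), smul_zero]

lemma coeff_zero_expSeries (f : PowerSeries A) : PowerSeries.coeff 0 (expSeries f) = 1 := by
  simp [expSeries]

/-- The differential equation of the exponential: `t (exp f)' = exp f * t f'`. -/
lemma smul_coeff_expSeries {f : PowerSeries A} (h0 : PowerSeries.coeff 0 f = 0)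
    (h : ∀ m n, Commute (PowerSeries.coeff m f) (PowerSeries.coeff n f)) (n : ℕ) :
    n • PowerSeries.coeff n (expSeries f) = ∑ p ∈ Finset.HasAntidiagonal.antidiagonal n,
      PowerSeries.coeff p.1 (expSeries f) * (p.2 • PowerSeries.coeff p.2 f) := by
  have h1 : ∀ r : ℕ, n • PowerSeries.coeff n (f ^ r) = PowerSeries.coeff n (eulerDeriv (f ^ r)) :=
    fun r => by rw [eulerDeriv, PowerSeries.coeff_mk]
  -- With cutoff n + 2, splitting off the vanishing term r = 0 and shifting r leaves the range n + 1
  -- used on the right; then (r + 1) / (r + 1)! = 1 / r!.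
  rw [coeff_expSeries_eq_sum_range h0 (show n < n + 1 + 1 by omega), Finset.sum_range_succ',
    smul_add, Finset.smul_sum]
  have h2 : n • (((Nat.factorial 0 : ℂ)⁻¹) • PowerSeries.coeff n (f ^ 0)) = 0 := by
    rw [pow_zero, PowerSeries.coeff_one]
    split_ifs with hn <;> simp [hn]
  rw [h2, add_zero]
  have h3 : ∀ p ∈ Finset.HasAntidiagonal.antidiagonal n,
      PowerSeries.coeff p.1 (expSeries f) * (p.2 • PowerSeries.coeff p.2 f) =
      ∑ r ∈ Finset.range (n + 1), ((r.factorial : ℂ)⁻¹) •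
        (PowerSeries.coeff p.1 (f ^ r) * (p.2 • PowerSeries.coeff p.2 f)) := fun p hp => by
    rw [coeff_expSeries_eq_sum_range h0
      (show p.1 < n + 1 by have := Finset.HasAntidiagonal.mem_antidiagonal.1 hp; omega),
      Finset.sum_mul]
    exact Finset.sum_congr rfl fun r _ => smul_mul_assoc _ _ _
  rw [Finset.sum_congr rfl h3, Finset.sum_comm]
  refine Finset.sum_congr rfl fun r _ => ?_
  rw [smul_comm, h1, eulerDeriv_pow h, map_nsmul, PowerSeries.coeff_mul, ← Nat.cast_smul_eq_nsmul ℂ,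
    smul_smul, Nat.factorial_succ, ← Finset.smul_sum]
  congr 1
  · have : ((r : ℂ) + 1) ≠ 0 := Nat.cast_add_one_ne_zero r
    push_cast
    field_simp
  · simp [eulerDeriv]

end ExpSeries

/-! ### Commutation relations -/

/-- The commutator of two derivations is a derivation, and this one kills the generators. -/
lemma commute_derivOp (k l : ℕ+) : Commute (derivOp k) (derivOp l) := by
  refine LinearMap.ext fun f => ?_
  have h : ⁅MvPolynomial.pderiv (R := ℂ) k, MvPolynomial.pderiv (R := ℂ) l⁆ = 0 := by
    refine MvPolynomial.derivation_ext fun i => ?_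
    rw [Derivation.commutator_apply]
    simp [MvPolynomial.pderiv_X, Pi.single_apply, apply_ite]
  have h := DFunLike.congr_fun h f
  rw [Derivation.commutator_apply, Derivation.zero_apply, sub_eq_zero] at h
  exact h

lemma commute_derivOp_coeff_derivSeries (k : ℕ+) (n : ℕ) :
    Commute (derivOp k) (PowerSeries.coeff n derivSeries) := by
  rw [derivSeries, PowerSeries.coeff_mk]
  split_ifs
  · exact (commute_derivOp _ _).neg_right
  · exact Commute.zero_right _

lemma commute_coeff_derivSeries (m n : ℕ) :
    Commute (PowerSeries.coeff m derivSeries) (PowerSeries.coeff n derivSeries) := by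
  rw [derivSeries, PowerSeries.coeff_mk, ← derivSeries]
  split_ifs
  · exact (commute_derivOp_coeff_derivSeries _ n).neg_left
  · exact Commute.zero_left _

lemma commute_annihilationCoeff (b d : ℕ) :
    Commute (annihilationCoeff b) (annihilationCoeff d) :=
  commute_coeff_expSeries (fun n =>
    (commute_coeff_expSeries (fun m => commute_coeff_derivSeries n m) b).symm) d

lemma annihilationCoeff_zero : annihilationCoeff 0 = 1 := coeff_zero_expSeries _

lemma coeff_zero_derivSeries : PowerSeries.coeff 0 derivSeries = 0 := by
  simp [derivSeries]

lemma coeff_zero_powerSumSeries : PowerSeries.coeff 0 powerSumSeries = 0 := by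
  simp [powerSumSeries]

/-- `n E_n = -∑_{k = 1}^n k E_{n - k} ∂/∂p_k`. -/
lemma smul_annihilationCoeff (n : ℕ) (f : SymFun) :
    (n : ℂ) • annihilationCoeff n f = -∑ k ∈ Finset.range n,
      ((k + 1 : ℕ) : ℂ) • annihilationCoeff (n - 1 - k) (derivOp k.succPNat f) := by
  have h := smul_coeff_expSeries coeff_zero_derivSeries commute_coeff_derivSeries n
  have h := congrArg (fun D : Module.End ℂ SymFun => D f) h
  cases n with
  | zero => simp
  | succ n =>
    rw [Finset.Nat.sum_antidiagonal_eq_sum_range_succ_mk, Finset.sum_range_succ] at h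
    rw [Nat.cast_smul_eq_nsmul]
    refine h.trans ?_
    rw [LinearMap.add_apply, LinearMap.sum_apply, ← Finset.sum_range_reflect]
    simp only [Nat.sub_self, zero_smul, mul_zero, LinearMap.zero_apply, add_zero]
    rw [← Finset.sum_neg_distrib]
    refine Finset.sum_congr rfl fun k hk => ?_
    have hk := Finset.mem_range.1 hk
    have e1 : n + 1 - (n + 1 - 1 - k) = k + 1 := by omega
    rw [e1, Module.End.mul_apply, LinearMap.smul_apply, map_nsmul, derivSeries,
      PowerSeries.coeff_mk, dif_pos (Nat.succ_pos k), LinearMap.neg_apply, map_neg, smul_neg,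
      Nat.cast_smul_eq_nsmul]
    rfl

/-! ### The functions h_a and their derivatives -/

lemma creationCoeff_of_neg {a : ℤ} (h : a < 0) : creationCoeff a = 0 := if_neg (by omega)

lemma creationCoeff_natCast (n : ℕ) :
    creationCoeff n = PowerSeries.coeff n (expSeries powerSumSeries) := by
  simp [creationCoeff]

/-- Newton's identity `n h_n = ∑_{k = 1}^n h_{n - k} p_k`. -/
lemma smul_creationCoeff (a : ℤ) {N : ℕ} (hN : a ≤ N) :
    (a : ℂ) • creationCoeff a = ∑ k ∈ Finset.range N,
      creationCoeff (a - (k + 1 : ℕ)) * MvPolynomial.X k.succPNat := by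
  rcases lt_or_ge a 0 with ha | ha
  · rw [creationCoeff_of_neg ha, smul_zero, Finset.sum_eq_zero]
    intro k _
    rw [creationCoeff_of_neg (by omega), zero_mul]
  · lift a to ℕ using ha
    have h := smul_coeff_expSeries coeff_zero_powerSumSeries (fun _ _ => Commute.all _ _) a
    rw [← creationCoeff_natCast, Finset.Nat.sum_antidiagonal_eq_sum_range_succ_mk,
      Finset.sum_range_succ, Nat.sub_self, zero_smul, mul_zero, add_zero,
      ← Finset.sum_range_reflect] at h
    rw [Int.cast_natCast, Nat.cast_smul_eq_nsmul, h]
    -- Summands with k ≥ a have negative index and vanish, so any bound N ≥ a will do.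
    have hs : Finset.range a ⊆ Finset.range N := by
      intro k; simp only [Finset.mem_range]; omega
    rw [← Finset.sum_subset hs]
    · refine Finset.sum_congr rfl fun k hk => ?_
      have hk := Finset.mem_range.1 hk
      have e1 : a - (a - 1 - k) = k + 1 := by omega
      have e2 : ((a : ℤ) - (k + 1 : ℕ)) = (a - 1 - k : ℕ) := by omega
      rw [e1, e2, creationCoeff_natCast, powerSumSeries, PowerSeries.coeff_mk,
        dif_pos (Nat.succ_pos k), ← Nat.cast_smul_eq_nsmul ℂ, smul_smul, mul_inv_cancel₀, one_smul]
      · rfl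
      · exact Nat.cast_ne_zero.2 (Nat.succ_ne_zero k)
    · intro k _ hk
      rw [creationCoeff_of_neg, zero_mul]
      simp only [Finset.mem_range] at hk
      omega

lemma derivOp_mul (k : ℕ+) (f g : SymFun) :
    derivOp k (f * g) = f * derivOp k g + g * derivOp k f := by
  simp [derivOp, Derivation.leibniz]

lemma derivOp_X (k l : ℕ) :
    derivOp k.succPNat (MvPolynomial.X l.succPNat) = if l = k then 1 else 0 := by
  simp only [derivOp, Derivation.coeFn_coe, MvPolynomial.pderiv_X, Pi.single_apply]
  congr 1
  simp [Nat.succPNat_inj]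

/-- `k ∂h_a/∂p_k = h_{a - k}`. -/
lemma smul_derivOp_creationCoeff (k : ℕ) (a : ℤ) :
    ((k + 1 : ℕ) : ℂ) • derivOp k.succPNat (creationCoeff a) = creationCoeff (a - (k + 1 : ℕ)) := by
  have hk : ((k + 1 : ℕ) : ℂ) ≠ 0 := Nat.cast_ne_zero.2 (Nat.succ_ne_zero k)
  rcases lt_or_ge a 0 with ha | ha
  · rw [creationCoeff_of_neg ha, creationCoeff_of_neg (by omega), map_zero, smul_zero]
  · lift a to ℕ using ha
    induction a using Nat.strong_induction_on with
    | _ a ih =>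
    rcases Nat.eq_zero_or_pos a with rfl | ha
    · rw [creationCoeff_natCast, coeff_zero_expSeries, creationCoeff_of_neg (by omega)]
      simp [derivOp]
    · have ha' : (a : ℂ) ≠ 0 := Nat.cast_ne_zero.2 ha.ne'
      refine smul_right_injective _ ha' ?_
      change (a : ℂ) • _ = (a : ℂ) • _
      -- Differentiate Newton's identity, with K = k + 1. The bound serves for both a and a - K and
      -- includes the summand l = k; the coefficients add up as (a - K) + K = a.
      have h := smul_creationCoeff a (N := a + k + 1) (by omega)
      rw [Int.cast_natCast] at h
      rw [smul_comm, ← map_smul, h, map_sum, Finset.smul_sum]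
      have h1 : ∀ l ∈ Finset.range (a + k + 1), ((k + 1 : ℕ) : ℂ) •
          derivOp k.succPNat (creationCoeff (a - (l + 1 : ℕ)) * MvPolynomial.X l.succPNat) =
          creationCoeff ((a - (k + 1 : ℕ) : ℤ) - (l + 1 : ℕ)) * MvPolynomial.X l.succPNat +
          if l = k then ((k + 1 : ℕ) : ℂ) • creationCoeff (a - (k + 1 : ℕ)) else 0 := by
        intro l _
        rw [derivOp_mul, derivOp_X, smul_add, add_comm, ← mul_smul_comm, mul_comm]
        congr 1
        · rw [show (a - (k + 1 : ℕ) : ℤ) - (l + 1 : ℕ) = (a - (l + 1 : ℕ) : ℤ) - (k + 1 : ℕ) by ring]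
          congr 1
          rcases lt_or_ge ((a - (l + 1 : ℕ)) : ℤ) 0 with hl | hl
          · rw [creationCoeff_of_neg hl, creationCoeff_of_neg (by omega), map_zero, smul_zero]
          · have := ih (a - (l + 1)) (by omega)
            rwa [show ((a - (l + 1) : ℕ) : ℤ) = a - (l + 1 : ℕ) by omega] at this
        · split_ifs with hl
          · rw [hl, mul_one]
          · rw [mul_zero, smul_zero]
      rw [Finset.sum_congr rfl h1, Finset.sum_add_distrib, Finset.sum_ite_eq',
        if_pos (Finset.mem_range.2 (by omega)),
        ← smul_creationCoeff (a - (k + 1 : ℕ)) (N := a + k + 1) (by omega), ← add_smul]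
      congr 1
      push_cast
      ring

/-- `E_b h_a = h_a E_b - h_{a - 1} E_{b - 1}` as operators on `Λ`. -/
lemma annihilationCoeff_succ_creationCoeff_mul (b : ℕ) (a : ℤ) (f : SymFun) :
    annihilationCoeff (b + 1) (creationCoeff a * f) =
      creationCoeff a * annihilationCoeff (b + 1) f -
        creationCoeff (a - 1) * annihilationCoeff b f := by
  induction b using Nat.strong_induction_on generalizing a f with
  | _ b ih =>
  have hb : ((b + 1 : ℕ) : ℂ) ≠ 0 := Nat.cast_ne_zero.2 (Nat.succ_ne_zero b)
  refine smul_right_injective _ hb ?_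
  change ((b + 1 : ℕ) : ℂ) • _ = ((b + 1 : ℕ) : ℂ) • _
  rw [smul_annihilationCoeff, smul_sub, ← mul_smul_comm, smul_annihilationCoeff]
  have ih0 : ∀ (a : ℤ) (f : SymFun), annihilationCoeff 0 (creationCoeff a * f) =
      creationCoeff a * annihilationCoeff 0 f := fun a f => by
    rw [annihilationCoeff_zero]; rfl
  -- `D c` is the correction term in the commutation of `E_c` with `h_a`
  let D : ℕ → ℤ → SymFun → SymFun := fun c a f =>
    if c = 0 then 0 else creationCoeff (a - 1) * annihilationCoeff (c - 1) f
  have ih' : ∀ c ≤ b, ∀ (a : ℤ) (f : SymFun), annihilationCoeff c (creationCoeff a * f) =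
      creationCoeff a * annihilationCoeff c f - D c a f := by
    intro c hc a f
    cases c with
    | zero => simp [D, ih0]
    | succ c => simpa [D] using ih c (by omega) a f
  have hterm : ∀ k ∈ Finset.range (b + 1), ((k + 1 : ℕ) : ℂ) •
      annihilationCoeff (b + 1 - 1 - k) (derivOp k.succPNat (creationCoeff a * f)) =
      creationCoeff a * (((k + 1 : ℕ) : ℂ) •
        annihilationCoeff (b + 1 - 1 - k) (derivOp k.succPNat f)) -
      ((k + 1 : ℕ) : ℂ) • D (b - k) a (derivOp k.succPNat f) +
      (creationCoeff (a - (k + 1 : ℕ)) * annihilationCoeff (b - k) f -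
        D (b - k) (a - (k + 1 : ℕ)) f) := by
    intro k _
    rw [Nat.add_sub_cancel, derivOp_mul, map_add, smul_add, ih' (b - k) (by omega), smul_sub,
      mul_smul_comm, ← ih' (b - k) (by omega), mul_comm f, ← map_smul,
      ← smul_mul_assoc _ (derivOp k.succPNat (creationCoeff a)), smul_derivOp_creationCoeff]
  rw [Finset.sum_congr rfl hterm, Finset.sum_add_distrib, Finset.sum_sub_distrib,
    Finset.sum_sub_distrib, ← Finset.mul_sum]
  have hD : ∀ k ∈ Finset.range b, ∀ (a : ℤ) (f : SymFun),
      D (b - k) a f = creationCoeff (a - 1) * annihilationCoeff (b - 1 - k) f := by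
    intro k hk a f
    have := Finset.mem_range.1 hk
    simp only [D, if_neg (show b - k ≠ 0 by omega), show b - k - 1 = b - 1 - k by omega]
  -- The recursion for E_b turns these corrections into b copies of h_{a-1} E_b f. The sums `h3` and
  -- `h2` differ by one more copy, which makes b + 1.
  have h1 : ∑ k ∈ Finset.range (b + 1), ((k + 1 : ℕ) : ℂ) • D (b - k) a (derivOp k.succPNat f) =
      -(creationCoeff (a - 1) * ((b : ℂ) • annihilationCoeff b f)) := by
    rw [smul_annihilationCoeff, mul_neg, neg_neg, Finset.mul_sum, Finset.sum_range_succ]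
    simp only [Nat.sub_self, D, if_true, smul_zero, add_zero]
    refine Finset.sum_congr rfl fun k hk => ?_
    rw [mul_smul_comm, ← hD k hk]
  have h2 : ∑ k ∈ Finset.range (b + 1), D (b - k) (a - (k + 1 : ℕ)) f =
      ∑ k ∈ Finset.range b,
        creationCoeff (a - (k + 1 + 1 : ℕ)) * annihilationCoeff (b - (k + 1)) f := by
    rw [Finset.sum_range_succ]
    simp only [Nat.sub_self, D, if_true, add_zero]
    refine Finset.sum_congr rfl fun k hk => ?_
    refine (hD k hk _ _).trans ?_
    congr 2
    · push_cast; ring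
    · congr 1; omega
  have h3 : ∑ k ∈ Finset.range (b + 1),
      creationCoeff (a - (k + 1 : ℕ)) * annihilationCoeff (b - k) f =
      ∑ k ∈ Finset.range b,
        creationCoeff (a - (k + 1 + 1 : ℕ)) * annihilationCoeff (b - (k + 1)) f +
      creationCoeff (a - 1) * annihilationCoeff b f := by
    rw [Finset.sum_range_succ', Nat.sub_zero, zero_add, Nat.cast_one]
  rw [h1, h2, h3, mul_smul_comm, Nat.cast_add, add_smul, Nat.cast_one, one_smul, mul_neg]
  abel

/-- The commutation relation `B_m B_n = -B_{n - 1} B_{m + 1}` of Bernstein operators. -/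
theorem bernstein_mul_bernstein (m n : ℤ) :
    bernstein m * bernstein n = -(bernstein (n - 1) * bernstein (m + 1)) := by
  refine LinearMap.ext fun f => ?_
  obtain ⟨N, hN⟩ : ∃ N, ∀ b ≥ N, annihilationCoeff b f = 0 := by
    obtain ⟨M, hM⟩ := (annihilationCoeff_support_finite f).bddAbove
    exact ⟨M + 1, fun b hb => by_contra fun h => absurd (hM h) (by omega)⟩
  have hE : ∀ b d, annihilationCoeff b (annihilationCoeff d f) =
      annihilationCoeff d (annihilationCoeff b f) := fun b d =>
    LinearMap.congr_fun (commute_annihilationCoeff b d).eq f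
  have happly : ∀ (n : ℤ) (M : ℕ) (g : SymFun), (∀ b ≥ M, annihilationCoeff b g = 0) →
      bernstein n g = ∑ b ∈ Finset.range M, creationCoeff (n + b) * annihilationCoeff b g := by
    intro n M g hg
    refine finsum_eq_sum_of_support_subset _ fun b hb => ?_
    by_contra hlt
    exact hb (by simp only [hg b (by simpa using hlt), mul_zero])
  -- The normally ordered product, symmetric because the h's commute among themselves and so do the
  -- E's.
  let T : ℤ → ℤ → SymFun := fun m n => ∑ b ∈ Finset.range N, ∑ d ∈ Finset.range N,
    creationCoeff (m + b) * (creationCoeff (n + d) * annihilationCoeff b (annihilationCoeff d f))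
  have hT : ∀ m n, T m n = T n m := fun m n => by
    simp only [T]
    rw [Finset.sum_comm]
    refine Finset.sum_congr rfl fun b _ => Finset.sum_congr rfl fun d _ => ?_
    rw [hE, mul_left_comm]
  have key : ∀ m n, (bernstein m * bernstein n) f = T m n - T (m + 1) (n - 1) := by
    intro m n
    have hsucc : ∀ b, annihilationCoeff (b + 1) (bernstein n f) =
        ∑ d ∈ Finset.range N,
          creationCoeff (n + d) * annihilationCoeff (b + 1) (annihilationCoeff d f) -
        ∑ d ∈ Finset.range N,
          creationCoeff (n - 1 + d) * annihilationCoeff b (annihilationCoeff d f) := fun b => by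
      rw [happly n N f hN, map_sum, ← Finset.sum_sub_distrib]
      refine Finset.sum_congr rfl fun d _ => ?_
      rw [annihilationCoeff_succ_creationCoeff_mul, show n + d - 1 = n - 1 + d by ring]
    have hzero : annihilationCoeff 0 (bernstein n f) = ∑ d ∈ Finset.range N,
        creationCoeff (n + d) * annihilationCoeff 0 (annihilationCoeff d f) := by
      rw [happly n N f hN, annihilationCoeff_zero]; rfl
    have hvan : ∀ b ≥ N, ∀ n : ℤ, ∑ d ∈ Finset.range N,
        creationCoeff (n + d) * annihilationCoeff b (annihilationCoeff d f) = 0 :=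
      fun b hb n => Finset.sum_eq_zero fun d _ => by rw [hE, hN b hb, map_zero, mul_zero]
    -- One more term than for f: commuting E_N past h also leaves E_{N-1}, which need not kill f.
    rw [Module.End.mul_apply, happly m (N + 1)]
    · let G : ℕ → SymFun := fun b => ∑ d ∈ Finset.range N,
        creationCoeff (n + d) * annihilationCoeff b (annihilationCoeff d f)
      have h1 : ∑ b ∈ Finset.range (N + 1), creationCoeff (m + b) * G b =
          ∑ b ∈ Finset.range N, creationCoeff (m + b) * G b := by
        rw [Finset.sum_range_succ, show G N = 0 from hvan N le_rfl n, mul_zero, add_zero]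
      have h2 : ∑ b ∈ Finset.range (N + 1),
          creationCoeff (m + b) * (annihilationCoeff b (bernstein n f) - G b) =
            -T (m + 1) (n - 1) := by
        rw [Finset.sum_range_succ', show annihilationCoeff 0 (bernstein n f) = G 0 from hzero,
          sub_self, mul_zero, add_zero, ← Finset.sum_neg_distrib]
        refine Finset.sum_congr rfl fun b _ => ?_
        rw [hsucc, sub_sub_cancel_left, mul_neg, Finset.mul_sum,
          show m + ((b + 1 : ℕ) : ℤ) = m + 1 + b by push_cast; ring]
      have h3 : T m n = ∑ b ∈ Finset.range N, creationCoeff (m + b) * G b :=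
        Finset.sum_congr rfl fun b _ => (Finset.mul_sum _ _ _).symm
      rw [h3, ← h1, sub_eq_add_neg, ← h2, ← Finset.sum_add_distrib]
      exact Finset.sum_congr rfl fun b _ => by rw [mul_sub, add_sub_cancel]
    · intro b hb
      obtain ⟨c, rfl⟩ : ∃ c, b = c + 1 := ⟨b - 1, by omega⟩
      rw [hsucc, hvan _ (by omega), hvan _ (by omega), sub_zero]
  rw [LinearMap.neg_apply, key, key, hT (n - 1), hT (n - 1 + 1), sub_add_cancel,
    add_sub_cancel_right, neg_sub]

/-! ### Products along a path -/

/-- The composite of the operators `B_x`, for `x` running through the list from its end (the top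
row) to its beginning (the bottom row). -/
noncomputable def bernsteinProd (xs : List ℤ) : Module.End ℂ SymFun :=
  (xs.reverse.map bernstein).prod

lemma bernsteinProd_append (xs ys : List ℤ) :
    bernsteinProd (xs ++ ys) = bernsteinProd ys * bernsteinProd xs := by
  simp [bernsteinProd]

lemma bernsteinProd_cons (x : ℤ) (ys : List ℤ) :
    bernsteinProd (x :: ys) = bernsteinProd ys * bernstein x := by
  simp [bernsteinProd]

lemma bernsteinProd_reverse_map (μ : List ℕ) :
    bernsteinProd (μ.reverse.map fun i : ℕ => (i : ℤ)) = bernsteinComp μ := by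
  simp [bernsteinProd, bernsteinComp, ← List.map_reverse, Function.comp_def]

/-- Moving an entry past `ys` changes the sign `ys.length` times. -/
lemma bernsteinProd_insert (x : ℤ) (pre ys rest : List ℤ) :
    bernsteinProd (pre ++ (ys ++ (x - ys.length) :: rest)) =
      ((-1 : ℂ) ^ ys.length) • bernsteinProd (pre ++ (x :: ys.map (· - 1) ++ rest)) := by
  induction ys generalizing x pre with
  | nil => simp
  | cons y ys ih =>
    have h := ih (x - 1) (pre ++ [y])
    have e : x - ((y :: ys).length : ℤ) = x - 1 - ys.length := by
      rw [List.length_cons]; push_cast; ring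
    rw [e, show pre ++ ((y :: ys) ++ (x - 1 - ys.length) :: rest) =
      pre ++ [y] ++ (ys ++ (x - 1 - ys.length) :: rest) by simp, h]
    simp only [List.append_assoc, List.cons_append, List.nil_append, List.map_cons,
      List.length_cons, bernsteinProd_append, bernsteinProd_cons]
    -- By induction the moving entry has become x - 1 just behind y; one more exchange gives x
    -- followed by y - 1.
    rw [mul_assoc (bernsteinProd rest * _), bernstein_mul_bernstein (x - 1) y, sub_add_cancel,
      ← neg_one_smul ℂ (bernstein _ * _), mul_smul_comm, smul_mul_assoc, smul_smul, ← pow_succ]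
    simp only [mul_assoc]

/-- The product vanishes if two entries agree up to the shift by their distance. -/
lemma bernsteinProd_eq_zero (x : ℤ) (pre ys rest : List ℤ) :
    bernsteinProd (pre ++ (x :: ys ++ (x - 1 - ys.length) :: rest)) = 0 := by
  have h := bernsteinProd_insert (x - 1) (pre ++ [x]) ys rest
  -- The commutation relation says here that the product is its own negative.
  have h0 : bernstein (x - 1) * bernstein x = 0 := by
    have := bernstein_mul_bernstein (x - 1) x
    rw [sub_add_cancel] at this
    rw [eq_neg_iff_add_eq_zero, ← two_smul ℂ] at this
    exact (smul_eq_zero_iff_right two_ne_zero).1 this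
  rw [show pre ++ (x :: ys ++ (x - 1 - ys.length) :: rest) =
    pre ++ [x] ++ (ys ++ (x - 1 - ys.length) :: rest) by simp, h]
  simp only [List.append_assoc, List.cons_append, List.nil_append, bernsteinProd_append,
    bernsteinProd_cons]
  rw [mul_assoc (bernsteinProd rest * _), h0, mul_zero, zero_mul, smul_zero]

/-! ### Up steps of paths -/

/-- The abscissa of the end of the path `v` that starts at abscissa `x`. -/
def endAbscissa (x : ℤ) (v : List Letter) : ℤ := x + v.count Letter.R - v.count Letter.L

lemma upSteps_append (x : ℤ) (v v' : List Letter) :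
    upSteps x (v ++ v') = upSteps x v ++ upSteps (endAbscissa x v) v' := by
  induction v generalizing x with
  | nil => simp [upSteps, endAbscissa]
  | cons a v ih =>
    cases a <;> simp only [List.cons_append, upSteps, ih]
    · congr 2
      simp [endAbscissa]; ring
    · congr 2
      simp [endAbscissa]; ring
    · simp [endAbscissa]

lemma map_upSteps (x d : ℤ) (v : List Letter) :
    (upSteps x v).map (· - d) = upSteps (x - d) v := by
  induction v generalizing x with
  | nil => rfl
  | cons a v ih =>
    cases a <;> simp only [upSteps, List.map_cons, ih]
    · rw [sub_add_eq_add_sub]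
    · rw [sub_right_comm]

lemma length_upSteps (x : ℤ) (v : List Letter) : (upSteps x v).length = v.count Letter.U := by
  induction v generalizing x with
  | nil => rfl
  | cons a v ih => cases a <;> simp [upSteps, ih]

/-- This converts positions in a word into abscissae: without `L`, every letter other than `U` is a
step to the right. -/
lemma endAbscissa_of_notMem_L {a : List Letter} (h : Letter.L ∉ a) (x : ℤ) :
    endAbscissa x a = x + a.length - a.count Letter.U := by
  rw [endAbscissa, List.count_eq_zero_of_not_mem h]
  have : a.length = a.count Letter.R + a.count Letter.U := by
    clear x
    induction a with
    | nil => rfl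
    | cons b a ih =>
      have ih := ih fun h' => h (List.mem_cons_of_mem _ h')
      cases b
      · simp [ih]; omega
      · simp at h
      · simp [ih]; omega
  omega

lemma le_of_mem_upSteps {a : List Letter} (h : Letter.L ∉ a) {x y : ℤ} (hy : y ∈ upSteps x a) :
    x ≤ y := by
  induction a generalizing x with
  | nil => simp [upSteps] at hy
  | cons b a ih =>
    have ih := @ih fun h' => h (List.mem_cons_of_mem _ h')
    cases b
    · have := ih hy; omega
    · simp at h
    · rw [upSteps, List.mem_cons] at hy
      rcases hy with rfl | hy
      · exact le_rfl
      · exact ih hy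

lemma pairwise_upSteps {a : List Letter} (h : Letter.L ∉ a) (x : ℤ) :
    (upSteps x a).Pairwise (· ≤ ·) := by
  induction a generalizing x with
  | nil => exact List.Pairwise.nil
  | cons b a ih =>
    have h' : Letter.L ∉ a := fun h' => h (List.mem_cons_of_mem _ h')
    cases b
    · exact ih h' _
    · simp at h
    · exact List.Pairwise.cons (fun y hy => le_of_mem_upSteps h' hy) (ih h' x)

/-! ### Sequences of letters -/

lemma ofWord_of_neg (v : List Letter) {i : ℤ} (hi : i < 0) : Code.ofWord v i = Letter.U :=
  if_pos hi

lemma ofWord_natCast (v : List Letter) (n : ℕ) : Code.ofWord v n = v.getD n Letter.R := by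
  simp [Code.ofWord]

lemma ofWord_ext {v : List Letter} {w : Code} (h0 : ∀ i < 0, w i = Letter.U)
    (h : ∀ n : ℕ, w n = v.getD n Letter.R) : w = Code.ofWord v := by
  funext i
  rcases lt_or_ge i 0 with hi | hi
  · rw [h0 i hi, ofWord_of_neg v hi]
  · lift i to ℕ using hi
    rw [h, ofWord_natCast]

lemma ofWord_append_R (v : List Letter) : Code.ofWord (v ++ [Letter.R]) = Code.ofWord v := by
  refine ofWord_ext (fun i hi => ofWord_of_neg _ hi) fun n => ?_
  rw [ofWord_natCast]
  rcases lt_trichotomy n v.length with h | rfl | h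
  · rw [List.getD_append _ _ _ _ h]
  · simp
  · rw [List.getD_eq_default _ _ (by simp; omega), List.getD_eq_default _ _ (by omega)]

lemma ofWord_append_cons_length (a : List Letter) (b : Letter) (v : List Letter) :
    Code.ofWord (a ++ b :: v) a.length = b := by
  rw [ofWord_natCast]; simp

lemma delete_ofWord (a : List Letter) (b : Letter) (v : List Letter) :
    (Code.ofWord (a ++ b :: v)).delete a.length = Code.ofWord (a ++ v) := by
  refine ofWord_ext (fun i hi => ?_) fun n => ?_
  · rw [Code.delete, if_pos (by omega), ofWord_of_neg _ hi]
  · rw [Code.delete]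
    split_ifs with h
    · have h : n < a.length := by omega
      rw [ofWord_natCast, List.getD_append _ _ _ _ h, List.getD_append _ _ _ _ h]
    · have h : a.length ≤ n := by omega
      rw [show (n : ℤ) + 1 = (n + 1 : ℕ) by push_cast; rfl, ofWord_natCast,
        List.getD_append_right _ _ _ _ h, List.getD_append_right _ _ _ _ (by omega),
        show n + 1 - a.length = n - a.length + 1 by omega, List.getD_cons_succ]

lemma update_ofWord (a : List Letter) (b b' : Letter) (v : List Letter) :
    Function.update (Code.ofWord (a ++ b :: v)) a.length b' = Code.ofWord (a ++ b' :: v) := by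
  refine ofWord_ext (fun i hi => ?_) fun n => ?_
  · rw [Function.update_of_ne (by omega), ofWord_of_neg _ hi]
  · rcases lt_trichotomy n a.length with h | rfl | h
    · rw [Function.update_of_ne (by omega), ofWord_natCast, List.getD_append _ _ _ _ h,
        List.getD_append _ _ _ _ h]
    · rw [Function.update_self]; simp
    · rw [Function.update_of_ne (by omega), ofWord_natCast,
        List.getD_append_right _ _ _ _ h.le, List.getD_append_right _ _ _ _ h.le,
        show n - a.length = n - a.length - 1 + 1 by omega, List.getD_cons_succ, List.getD_cons_succ]

/-- Identifies the increment of j with the number of entries that the moved operator passes. -/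
lemma card_filter_ofWord (a a' v : List Letter) (b : Letter) :
    ((Finset.Ioo (a.length : ℤ) (a ++ b :: a').length).filter fun i =>
      Code.ofWord (a ++ b :: a' ++ v) i = Letter.U).card = a'.count Letter.U := by
  induction a' using List.reverseRecOn generalizing v with
  | nil =>
    rw [List.count_nil, Finset.card_eq_zero, Finset.filter_eq_empty_iff]
    intro i hi
    rw [Finset.mem_Ioo] at hi
    simp at hi; omega
  | append_singleton a' l ih =>
    have h1 : Finset.Ioo (a.length : ℤ) (a ++ b :: (a' ++ [l])).length =
        insert ((a ++ b :: a').length : ℤ) (Finset.Ioo (a.length : ℤ) (a ++ b :: a').length) := by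
      ext i
      simp only [Finset.mem_insert, Finset.mem_Ioo, List.length_append, List.length_cons,
        List.length_nil]
      push_cast
      omega
    have h2 := ih (l :: v)
    rw [show a ++ b :: (a' ++ [l]) ++ v = (a ++ b :: a') ++ l :: v by simp, h1,
      Finset.filter_insert, ofWord_append_cons_length]
    split_ifs with h
    · rw [Finset.card_insert_of_notMem (by simp), h2, h]; simp
    · rw [h2]; simp [h]

lemma notMem_L_of_ofWord {a : List Letter} (h : Letter.L ∉ a) (i : ℤ) :
    Code.ofWord a i ≠ Letter.L := by
  rw [Code.ofWord]
  split_ifs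
  · simp
  · intro hi
    rw [List.getD_eq_getElem?_getD] at hi
    rcases hh : a[i.toNat]? with _ | l
    · simp [hh] at hi
    · rw [hh] at hi
      exact h (hi ▸ List.mem_of_getElem? hh)

/-! ### Recovering compositions and partitions from codes -/

lemma ofWord_cons_natCast_succ (b : Letter) (v : List Letter) (n : ℕ) :
    Code.ofWord (b :: v) (n + 1 : ℕ) = Code.ofWord v n := by
  rw [ofWord_natCast, ofWord_natCast, List.getD_cons_succ]

lemma upSteps_eq_nil_of_ofWord {v : List Letter} (h : ∀ n : ℕ, Code.ofWord v n = Letter.R) (x : ℤ) :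
    upSteps x v = [] := by
  induction v generalizing x with
  | nil => rfl
  | cons b v ih =>
    obtain rfl : b = Letter.R := by simpa [Code.ofWord] using h 0
    exact ih (fun n => by rw [← ofWord_cons_natCast_succ Letter.R, h]) _

/-- The up steps of a path can be read off from its code. -/
lemma upSteps_congr_of_ofWord {v v' : List Letter}
    (h : ∀ n : ℕ, Code.ofWord v n = Code.ofWord v' n) (x : ℤ) : upSteps x v = upSteps x v' := by
  induction v generalizing v' x with
  -- Words with the same code may differ by trailing `R`s, which contribute no up steps.
  | nil => exact (upSteps_eq_nil_of_ofWord (fun n => by rw [← h]; simp [ofWord_natCast]) x).symm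
  | cons b v ih =>
    cases v' with
    | nil => exact upSteps_eq_nil_of_ofWord (fun n => by rw [h]; simp [ofWord_natCast]) x
    | cons b' v' =>
      obtain rfl : b = b' := by simpa [Code.ofWord] using h 0
      have hv : ∀ x, upSteps x v = upSteps x v' := ih fun n => by
        rw [← ofWord_cons_natCast_succ b, h, ofWord_cons_natCast_succ]
      cases b <;> simp only [upSteps, hv]

lemma code_injective : Function.Injective code := by
  intro l l' h
  have h1 := upSteps_congr_of_ofWord (fun n => congrFun h n) ((0 : ℕ) : ℤ)
  rw [upSteps_edgeWord, upSteps_edgeWord] at h1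
  exact List.reverse_injective (List.map_injective_iff.2 Nat.cast_injective h1)

/-- A path without left steps is the reduced path of its up steps, followed by right steps. -/
lemma exists_edgeWord_append_replicate {a : List Letter} (h : Letter.L ∉ a) (x : ℕ) :
    ∃ k, a = edgeWord x ((upSteps x a).map Int.toNat) ++ List.replicate k Letter.R := by
  induction a generalizing x with
  | nil => exact ⟨0, rfl⟩
  | cons b a ih =>
    have h' : Letter.L ∉ a := fun h' => h (List.mem_cons_of_mem _ h')
    cases b
    · obtain ⟨k, hk⟩ := ih h' (x + 1)
      rw [upSteps]
      push_cast at hk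
      have hle : ∀ y ∈ upSteps (x + 1) a, (x : ℤ) + 1 ≤ y := fun y hy => le_of_mem_upSteps h' hy
      -- If no up step follows, this `R` belongs to the tail; otherwise it lengthens the run before
      -- the next `U`.
      rcases hu : upSteps (x + 1) a with _ | ⟨y, ys⟩
      · refine ⟨k + 1, ?_⟩
        rw [hu] at hk
        rw [List.replicate_succ]
        simpa [edgeWord] using hk
      · refine ⟨k, ?_⟩
        rw [hu] at hk hle
        have hy := hle y (by simp)
        rw [hk, List.map_cons, edgeWord, edgeWord,
          show y.toNat - x = y.toNat - (x + 1) + 1 by omega,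
          show x - y.toNat = 0 by omega, show x + 1 - y.toNat = 0 by omega, List.replicate_succ]
        simp
    · simp at h
    · obtain ⟨k, hk⟩ := ih h' x
      exact ⟨k, by simpa [upSteps, edgeWord] using hk⟩

lemma ofWord_append_replicate_R (v : List Letter) (k : ℕ) :
    Code.ofWord (v ++ List.replicate k Letter.R) = Code.ofWord v := by
  induction k with
  | zero => simp
  | succ k ih => rw [List.replicate_succ', ← List.append_assoc, ofWord_append_R, ih]

/-- A word without `L` is the code of a partition. -/
lemma exists_partition_code {a : List Letter} (h : Letter.L ∉ a) :
    ∃ l : List ℕ, l.SortedGE ∧ code l = Code.ofWord a ∧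
      l.reverse.map (fun i : ℕ => (i : ℤ)) = upSteps 0 a := by
  -- Without `L` the abscissae never drop below 0, so `Int.toNat` loses nothing.
  have hm : ((upSteps 0 a).map Int.toNat).map (fun i : ℕ => (i : ℤ)) = upSteps 0 a := by
    rw [List.map_map]
    conv_rhs => rw [← List.map_id (upSteps 0 a)]
    refine List.map_congr_left fun y hy => ?_
    have := le_of_mem_upSteps h hy
    simp [this]
  refine ⟨((upSteps 0 a).map Int.toNat).reverse, ?_, ?_, ?_⟩
  · rw [List.sortedGE_iff_pairwise, List.pairwise_reverse, List.pairwise_map]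
    exact (pairwise_upSteps h 0).imp fun h => Int.toNat_le_toNat h
  · obtain ⟨k, hk⟩ := exists_edgeWord_append_replicate h 0
    rw [code, List.reverse_reverse]
    conv_rhs => rw [hk, ofWord_append_replicate_R]
    simp
  · rw [List.reverse_reverse, hm]

/-! ### The algorithm -/

/-- The rules have disjoint guards, and the leftmost `L` is unique. -/
lemma Step.deterministic {s t t' : State} (h : Step s t) (h' : Step s t') : t = t' := by
  cases h with
  | start w r j hr hl =>
    cases h' with
    | start _ r' _ hr' hl' =>
      rcases lt_trichotomy r r' with h | rfl | h
      · exact absurd hr (hl' _ h)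
      · rfl
      · exact absurd hr' (hl _ h)
  | finish w r j => cases h' <;> first | rfl | contradiction
  | readL w r c j hc hr => cases h' <;> simp_all
  | readR w r c j hc hr => cases h' <;> simp_all
  | readUU w r c j hc hr hw => cases h' <;> simp_all
  | readUR w r c j hc hr hw => cases h' <;> simp_all

lemma Final.not_step {s t : State} (h : Final s) : ¬ Step s t := by
  intro h'
  cases h with
  | zero => cases h'
  | word w j hw => cases h' with | start _ r _ hr _ => exact hw r hr

/-- Of two states reached by a deterministic relation, one is reachable from the other; final states
have no successor. -/
lemma EndsIn.unique {α : Code} {s t : State} (hs : EndsIn α s) (ht : EndsIn α t) : s = t := by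
  rcases Relation.ReflTransGen.total_of_right_unique (r := Step)
    (fun _ _ _ h h' => Step.deterministic h h') hs.1 ht.1 with h | h
  · rcases Relation.ReflTransGen.cases_head h with h | ⟨u, hu, -⟩
    · exact h
    · exact absurd hu hs.2.not_step
  · rcases Relation.ReflTransGen.cases_head h with h | ⟨u, hu, -⟩
    · exact h.symm
    · exact absurd hu ht.2.not_step

/-- The final state `s` is a correct outcome for the operator `B` and the length `l`. -/
def Correct (B : Module.End ℂ SymFun) (l : ℕ) (s : State) : Prop :=
  (s = .zero ∧ B = 0) ∨ ∃ a j, s = .between (Code.ofWord a) j ∧ Letter.L ∉ a ∧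
    (upSteps 0 a).length = l ∧ B = ((-1 : ℂ) ^ j) • bernsteinProd (upSteps 0 a)

/-- From the state `s` the algorithm reaches a correct final state. -/
def Terminates (B : Module.End ℂ SymFun) (l : ℕ) (s : State) : Prop :=
  ∃ t, Relation.ReflTransGen Step s t ∧ Final t ∧ Correct B l t

lemma Terminates.of_step {B : Module.End ℂ SymFun} {l : ℕ} {s s' : State} (h : Step s s')
    (h' : Terminates B l s') : Terminates B l s :=
  let ⟨t, ht, hf⟩ := h'
  ⟨t, .head h ht, hf⟩

/-- Invariant of a pass: letters up to `r` form the word `a` without `L`, the unread letters the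
path `v`, whose abscissae are counted as if it started in the current position. -/
def Reading (B : Module.End ℂ SymFun) (l : ℕ) (a v : List Letter) (c : ℤ) (j : ℕ) : Prop :=
  Letter.L ∉ a ∧ c ≤ a.length ∧ (∀ x ∈ upSteps (c - a.count Letter.U) v, 0 ≤ x) ∧
    (upSteps 0 a ++ upSteps (c - a.count Letter.U) v).length = l ∧
    B = ((-1 : ℂ) ^ j) • bernsteinProd (upSteps 0 a ++ upSteps (c - a.count Letter.U) v)

/-- Invariant between two passes. -/
def Between (B : Module.End ℂ SymFun) (l : ℕ) (v : List Letter) (j : ℕ) : Prop :=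
  (∀ x ∈ upSteps 0 v, 0 ≤ x) ∧ (upSteps 0 v).length = l ∧
    B = ((-1 : ℂ) ^ j) • bernsteinProd (upSteps 0 v)

/-- At c = `a.length` the abscissa assigned to the start of `v` is that of the end of `a`. -/
lemma Reading.between {B : Module.End ℂ SymFun} {l : ℕ} {a v : List Letter} {j : ℕ}
    (h : Reading B l a v a.length j) : Between B l (a ++ v) j := by
  obtain ⟨ha, -, hpos, hl, hB⟩ := h
  have e : upSteps 0 (a ++ v) = upSteps 0 a ++ upSteps (a.length - a.count Letter.U) v := by
    rw [upSteps_append, endAbscissa_of_notMem_L ha, zero_add]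
  refine ⟨fun x hx => ?_, by rw [e, hl], by rw [e, hB]⟩
  rw [e, List.mem_append] at hx
  exact hx.elim (le_of_mem_upSteps ha) (hpos x)

/-- The deleted `L` ended one unit left of the end of `a`, hence the position `a.length - 1`. -/
lemma Between.reading {B : Module.End ℂ SymFun} {l : ℕ} {a v : List Letter} {j : ℕ}
    (ha : Letter.L ∉ a) (h : Between B l (a ++ Letter.L :: v) j) :
    Reading B l a v (a.length - 1) j := by
  obtain ⟨hpos, hl, hB⟩ := h
  have e : upSteps 0 (a ++ Letter.L :: v) =
      upSteps 0 a ++ upSteps (a.length - 1 - a.count Letter.U) v := by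
    rw [upSteps_append, endAbscissa_of_notMem_L ha, zero_add, upSteps, sub_right_comm]
  rw [e] at hpos hl hB
  exact ⟨ha, by omega, fun x hx => hpos x (List.mem_append_right _ hx), hl, hB⟩

/-- A pass can be started, or the algorithm has ended. -/
lemma Between.terminates {B : Module.End ℂ SymFun} {l : ℕ} {a v : List Letter} {j : ℕ}
    (ha : Letter.L ∉ a) (h : Between B l (a ++ v) j)
    (ih : ∀ a' v' c, v'.length < v.length → Reading B l a' v' c j →
      Terminates B l (.reading (Code.ofWord (a' ++ v')) a'.length c j)) :
    Terminates B l (.between (Code.ofWord (a ++ v)) j) := by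
  by_cases hv : Letter.L ∈ v
  · obtain ⟨a', v', rfl, ha'⟩ := List.eq_append_cons_of_mem hv
    rw [← List.append_assoc] at h ⊢
    have haa : Letter.L ∉ a ++ a' := by simp [ha, ha']
    refine .of_step (.start _ ((a ++ a').length : ℤ) j (ofWord_append_cons_length _ _ _) ?_) ?_
    · intro i hi
      rcases lt_or_ge i 0 with h0 | h0
      · simp [ofWord_of_neg _ h0]
      · lift i to ℕ using h0
        rw [ofWord_natCast, List.getD_append _ _ _ _ (by omega), ← ofWord_natCast]
        exact notMem_L_of_ofWord haa _
    · rw [delete_ofWord]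
      exact ih _ _ _ (by simp; omega) (h.reading haa)
  · have hav : Letter.L ∉ a ++ v := by simp [ha, hv]
    exact ⟨_, .refl, .word _ _ (notMem_L_of_ofWord hav), .inr ⟨_, _, rfl, hav, h.2⟩⟩

/-- The step in which a `U` is read. -/
lemma Reading.terminates_U {B : Module.End ℂ SymFun} {l : ℕ} {a v : List Letter} {c : ℤ} {j : ℕ}
    (h : Reading B l a (Letter.U :: v) c j) (hc : c ≠ a.length)
    (ih : ∀ a' c' j', Reading B l a' v c' j' →
      Terminates B l (.reading (Code.ofWord (a' ++ v)) a'.length c' j')) :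
    Terminates B l (.reading (Code.ofWord (a ++ Letter.U :: v)) a.length c j) := by
  obtain ⟨ha, hle, hpos, hl, hB⟩ := h
  -- The `U` read has abscissa c - #U(a) ≥ 0, so the current position is not among the `U`s of the
  -- negative axis.
  have hc0 : 0 ≤ c := by
    have := hpos (c - a.count Letter.U) (by simp [upSteps])
    omega
  lift c to ℕ using hc0
  obtain ⟨a₁, b, a₂, rfl, rfl⟩ : ∃ a₁ b a₂, a = a₁ ++ b :: a₂ ∧ c = a₁.length := by
    have hlt : c < a.length := by omega
    refine ⟨a.take c, a[c], a.drop (c + 1), ?_, ?_⟩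
    · simp
    · simp; omega
  have ha₁ : Letter.L ∉ a₁ := fun h => ha (by simp [h])
  have hr : Code.ofWord (a₁ ++ b :: a₂ ++ Letter.U :: v) (a₁ ++ b :: a₂).length = Letter.U :=
    ofWord_append_cons_length _ _ _
  have hw : Code.ofWord (a₁ ++ b :: a₂ ++ Letter.U :: v) a₁.length = b := by
    rw [List.append_assoc]; exact ofWord_append_cons_length _ _ _
  have hx : endAbscissa 0 a₁ = a₁.length - a₁.count Letter.U := by
    rw [endAbscissa_of_notMem_L ha₁, zero_add]
  cases b with
  | L => exact absurd ha (by simp)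
  | U =>
    refine ⟨.zero, .single (.readUU _ _ _ _ hc hr hw), .zero, .inl ⟨rfl, ?_⟩⟩
    rw [hB, upSteps_append, hx]
    simp only [upSteps, List.count_append, List.count_cons_self]
    -- The two clashing entries are the `U` in the current position and the `U` read, with the up
    -- steps of a₂ between them.
    have := bernsteinProd_eq_zero (a₁.length - a₁.count Letter.U) (upSteps 0 a₁)
      (upSteps (a₁.length - a₁.count Letter.U) a₂)
      (upSteps (a₁.length - (a₁.count Letter.U + (a₂.count Letter.U + 1) : ℕ)) v)
    rw [length_upSteps] at this
    rw [List.append_assoc]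
    convert smul_zero _
    convert this using 5
    push_cast; ring
  | R =>
    refine .of_step (.readUR _ _ _ _ hc hr hw) ?_
    rw [card_filter_ofWord, List.append_assoc, List.cons_append, update_ofWord,
      show ((a₁ ++ Letter.R :: a₂).length : ℤ) = (a₁ ++ Letter.U :: a₂).length by simp,
      ← List.cons_append, ← List.append_assoc, delete_ofWord]
    -- Once the entry is moved, the up steps of a₂ start one unit further left, as they do when the
    -- `R` before them becomes a `U`.
    have hins := bernsteinProd_insert (a₁.length - a₁.count Letter.U) (upSteps 0 a₁)
      (upSteps (a₁.length - a₁.count Letter.U + 1) a₂)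
      (upSteps (a₁.length - (a₁.count Letter.U + a₂.count Letter.U : ℕ)) v)
    rw [length_upSteps, map_upSteps, add_sub_cancel_right] at hins
    have e1 : upSteps 0 (a₁ ++ Letter.R :: a₂) ++
        upSteps (a₁.length - (a₁ ++ Letter.R :: a₂).count Letter.U) (Letter.U :: v) =
        upSteps 0 a₁ ++ (upSteps (a₁.length - a₁.count Letter.U + 1) a₂ ++
          ((a₁.length : ℤ) - a₁.count Letter.U - a₂.count Letter.U) ::
          upSteps (a₁.length - (a₁.count Letter.U + a₂.count Letter.U : ℕ)) v) := by
      rw [upSteps_append, hx, List.append_assoc]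
      simp only [upSteps, List.count_append, List.count_cons_of_ne (show Letter.R ≠ Letter.U by simp)]
      push_cast
      rw [sub_sub]
    -- The move of c to the right offsets the new `U` in `a`, so the unread path keeps its
    -- abscissae.
    have e2 : ((a₁.length : ℤ) + 1 - (a₁ ++ Letter.U :: a₂).count Letter.U) =
        a₁.length - (a₁.count Letter.U + a₂.count Letter.U : ℕ) := by
      simp only [List.count_append, List.count_cons_self]
      push_cast; ring
    have e3 : upSteps 0 (a₁ ++ Letter.U :: a₂) ++
        upSteps (a₁.length + 1 - (a₁ ++ Letter.U :: a₂).count Letter.U) v =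
        upSteps 0 a₁ ++ (((a₁.length : ℤ) - a₁.count Letter.U) ::
          upSteps (a₁.length - a₁.count Letter.U) a₂ ++
          upSteps (a₁.length - (a₁.count Letter.U + a₂.count Letter.U : ℕ)) v) := by
      rw [upSteps_append, hx, List.append_assoc, e2]
      simp only [upSteps]
    rw [e1] at hl hB
    refine ih _ _ _ ⟨?_, ?_, ?_, ?_, ?_⟩
    · simpa using ha
    · simp
    · rw [e2]
      intro x hx
      refine hpos x ?_
      rw [upSteps]
      refine List.mem_cons_of_mem _ ?_
      simpa [List.count_append] using hx
    · rw [e3, ← hl]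
      simp only [List.length_append, List.length_cons, length_upSteps]
      omega
    · rw [e3, hB, hins, smul_smul, ← pow_add]

/-- Strong induction on the number of unread letters of the finite path, across passes; once they
are exhausted, each `R` of the axis brings c closer to the end of `a`. -/
lemma Reading.terminates {B : Module.End ℂ SymFun} {l : ℕ} {a v : List Letter} {c : ℤ} {j : ℕ}
    (h : Reading B l a v c j) :
    Terminates B l (.reading (Code.ofWord (a ++ v)) a.length c j) := by
  induction hn : v.length using Nat.strong_induction_on generalizing a v c j with
  | _ n ih =>
  subst hn
  by_cases hc : c = a.length
  · subst hc
    exact .of_step (.finish _ _ _) (h.between.terminates h.1 fun a' v' c hv hr => ih _ hv hr rfl)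
  rcases v with _ | ⟨b, v⟩
  · -- only the right steps of the positive axis are left to be read
    obtain ⟨k, hk⟩ : ∃ k : ℕ, a.length - c = k := ⟨(a.length - c).toNat, by have := h.2.1; omega⟩
    induction k generalizing c with
    | zero => omega
    | succ k ihk =>
      rw [List.append_nil] at ihk ⊢
      refine .of_step (.readR _ _ _ _ hc ?_) ?_
      · rw [ofWord_natCast, List.getD_eq_default _ _ le_rfl]
      · have hd : (Code.ofWord a).delete a.length = Code.ofWord a := by
          conv_lhs => rw [← ofWord_append_R]
          rw [delete_ofWord, List.append_nil]
        rw [hd]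
        have hr : Reading B l a [] (c + 1) j := ⟨h.1, by omega, by simp [upSteps], h.2.2.2⟩
        by_cases hc' : c + 1 = a.length
        · rw [hc'] at hr ⊢
          refine .of_step (.finish _ _ _) ?_
          have := hr.between.terminates h.1 fun a' v' c hv _ => absurd hv (by simp)
          rwa [List.append_nil] at this
        · exact ihk hc' hr (by omega)
  · have hlt : v.length < (b :: v).length := by simp
    cases b with
    | U => exact h.terminates_U hc fun a' c' j' h' => ih _ hlt h' rfl
    | L =>
      refine .of_step (.readL _ _ _ _ hc (ofWord_append_cons_length _ _ _)) ?_
      rw [delete_ofWord]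
      refine ih _ hlt ⟨h.1, by have := h.2.1; omega, ?_⟩ rfl
      have := h.2.2
      rwa [upSteps, sub_right_comm] at this
    | R =>
      refine .of_step (.readR _ _ _ _ hc (ofWord_append_cons_length _ _ _)) ?_
      rw [delete_ofWord]
      refine ih _ hlt ⟨h.1, by have := h.2.1; omega, ?_⟩ rfl
      have := h.2.2
      rwa [upSteps, sub_add_eq_add_sub] at this

/-- On a code of `μ` the algorithm terminates with a correct outcome. -/
lemma IsCode.exists_endsIn {α : Code} {μ : List ℕ} (h : IsCode α μ) :
    ∃ s, EndsIn α s ∧ Correct (bernsteinComp μ) μ.length s := by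
  obtain ⟨v, rfl, hv⟩ := h
  have hb : Between (bernsteinComp μ) μ.length ([] ++ v) 0 := by
    refine ⟨?_, ?_, ?_⟩ <;> rw [List.nil_append, hv]
    · simp
    · simp
    · rw [bernsteinProd_reverse_map, pow_zero, one_smul]
  obtain ⟨s, hs, hf, hc⟩ := hb.terminates (by simp) fun a' v' c _ hr => hr.terminates
  exact ⟨s, ⟨hs, hf⟩, hc⟩

end BernsteinCode

/-! ### The theorem -/

theorem mainTheorem12 (μ : List ℕ) (α : BernsteinCode.Code) (hα : BernsteinCode.IsCode α μ) :
    (∃! s : BernsteinCode.State, BernsteinCode.EndsIn α s) ∧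
    (BernsteinCode.EndsIn α .zero → BernsteinCode.bernsteinComp μ = 0) ∧
    (∀ (w : BernsteinCode.Code) (j : ℕ), BernsteinCode.EndsIn α (.between w j) →
      (∃! l : List ℕ, l.SortedGE ∧ BernsteinCode.code l = w) ∧
      ∀ l : List ℕ, l.SortedGE → BernsteinCode.code l = w →
        l.length = μ.length ∧
        BernsteinCode.bernsteinComp μ = ((-1 : ℂ) ^ j) • BernsteinCode.bernsteinComp l) := by
  obtain ⟨s, hs, hc⟩ := hα.exists_endsIn
  refine ⟨⟨s, hs, fun t ht => ht.unique hs⟩, fun h => ?_, fun w j h => ?_⟩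
  -- Uniqueness carries correctness from the constructed outcome to the given one.
  · rw [← h.unique hs] at hc
    rcases hc with ⟨-, h0⟩ | ⟨a, j, h0, -⟩
    · exact h0
    · cases h0
  · rw [← h.unique hs] at hc
    rcases hc with ⟨h0, -⟩ | ⟨a, j', h0, ha, hl, hB⟩
    · cases h0
    · cases h0
      obtain ⟨p, hp, hcode, hup⟩ := BernsteinCode.exists_partition_code ha
      refine ⟨⟨p, ⟨hp, hcode⟩, fun q hq => BernsteinCode.code_injective (hq.2.trans hcode.symm)⟩,
        fun q _ hq => ?_⟩
      obtain rfl := BernsteinCode.code_injective (hq.trans hcode.symm)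
      rw [← hup] at hl hB
      rw [BernsteinCode.bernsteinProd_reverse_map] at hB
      exact ⟨by simpa using hl, hB⟩
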